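/- Let $\mathbb K=\mathbb R$ or $\mathbb C$, let $n\ge 1$ be an integer and let $E_1,\dots,E_n,F$ be Banach spaces over $\mathbb K$. For $1\le p<\infty$ and $x_1,\dots,x_m$ in a Banach space $E$ put $$\|(x_j)_{j=1}^m\|_{w,p}=\sup\Big\{\Big(\sum_{j=1}^m|\varphi(x_j)|^p\Big)^{1/p}:\varphi\in E',\ \|\varphi\|\le 1\Big\}.$$ Let $\Pi_p^n(E_1,\dots,E_n;F)$ denote the set of all continuous $n$-linear mappings $A:E_1\times\cdots\times E_n\to F$ that are multiple $(p;p)$-summing, i.e. for which there is a constant $C\ge 0$ such that $$\Big(\sum_{j_1=1}^{m_1}\cdots\sum_{j_n=1}^{m_n}\big\|A(x^{(1)}_{j_1},\dots,x^{(n)}_{j_n})\big\|^p\Big)^{1/p}\le C\prod_{k=1}^n\big\|(x^{(k)}_j)_{j=1}^{m_k}\big\|_{w,p}$$ for all $m_1,\dots,m_n\in\mathbb N$ and all $x^{(k)}_j\in E_k$, $1\le j\le m_k$, $1\le k\le n$. A Banach space $E$ has cotype $2$ if there is a constant $C\ge 0$ such that $$\Big(\sum_{j=1}^m\|x_j\|^2\Big)^{1/2}\le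 C\Big(2^{-m}\sum_{\varepsilon\in\{-1,1\}^m}\Big\|\sum_{j=1}^m\varepsilon_jx_j\Big\|^2\Big)^{1/2}$$ for all $m\in\mathbb N$ and all $x_1,\dots,x_m\in E$. **Theorem.** If $E_1,\dots,E_n$ and $F$ all have cotype $2$, then $$\Pi_p^n(E_1,\dots,E_n;F)=\Pi_r^n(E_1,\dots,E_n;F)\qquad\text{for all real } 1\le p\le r\le 2.$$ -/

import Mathlib

noncomputable section

/-- The weak `p`-norm `‖(x_j)_{j=1}^m‖_{w,p}` of a finite family: the supremum of
`(∑_j |φ(x_j)|^p)^{1/p}` over all `φ` in the closed unit ball of the dual of `E`. -/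
def weakNorm (𝕜 : Type*) [RCLike 𝕜] {E : Type*} [NormedAddCommGroup E] [NormedSpace 𝕜 E]
    (p : ℝ) {m : ℕ} (x : Fin m → E) : ℝ :=
  ⨆ φ : Metric.closedBall (0 : StrongDual 𝕜 E) 1,
    (∑ j, ‖(φ : StrongDual 𝕜 E) (x j)‖ ^ p) ^ (1 / p)

/-- The supremum in `weakNorm` is a genuine (finite) one. -/
theorem weakNorm_bddAbove (𝕜 : Type*) [RCLike 𝕜] {E : Type*} [NormedAddCommGroup E]
    [NormedSpace 𝕜 E] {p : ℝ} (hp : 1 ≤ p) {m : ℕ} (x : Fin m → E) :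
    BddAbove (Set.range fun φ : Metric.closedBall (0 : StrongDual 𝕜 E) 1 =>
      (∑ j, ‖(φ : StrongDual 𝕜 E) (x j)‖ ^ p) ^ (1 / p)) := by
  refine ⟨(∑ j, ‖x j‖ ^ p) ^ (1 / p), ?_⟩
  rintro _ ⟨⟨φ, hφ⟩, rfl⟩
  have hφ' : ‖φ‖ ≤ 1 := by simpa using hφ
  have h : ∀ j, ‖φ (x j)‖ ≤ ‖x j‖ := fun j => by
    simpa using φ.le_of_opNorm_le hφ' (x j)
  have hp0 : 0 ≤ p := by linarith
  dsimp only
  gcongr with j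
  exact h j

/-- `multipleSumming 𝕜 q p E F` is the set of all continuous `n`-linear mappings
`E₁ × ⋯ × Eₙ → F` that are multiple `(q; p₁, …, pₙ)`-summing (for `1 ≤ p_k ≤ q`). -/
def multipleSumming (𝕜 : Type*) [RCLike 𝕜] {n : ℕ} (q : ℝ) (p : Fin n → ℝ)
    (E : Fin n → Type*) [∀ k, NormedAddCommGroup (E k)] [∀ k, NormedSpace 𝕜 (E k)]
    (F : Type*) [NormedAddCommGroup F] [NormedSpace 𝕜 F] :
    Set (ContinuousMultilinearMap 𝕜 E F) :=
  {A | ∃ C : ℝ, 0 ≤ C ∧ ∀ (m : Fin n → ℕ) (x : ∀ k, Fin (m k) → E k),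
    (∑ j : (∀ k, Fin (m k)), ‖A (fun k => x k (j k))‖ ^ q) ^ (1 / q)
      ≤ C * ∏ k, weakNorm 𝕜 (p k) (x k)}

/-- `E` has (Rademacher) cotype `q`, for `2 ≤ q < ∞`: there is a constant `C` with
`(∑_j ‖x_j‖^q)^{1/q} ≤ C (𝔼 ‖∑_j ε_j x_j‖²)^{1/2}` for all finite families in `E`, where the
`ε_j` are independent uniformly distributed signs `±1`. -/
def HasCotype (q : ℝ) (E : Type*) [NormedAddCommGroup E] : Prop :=
  ∃ C : ℝ, 0 ≤ C ∧ ∀ (m : ℕ) (x : Fin m → E),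
    (∑ j, ‖x j‖ ^ q) ^ (1 / q)
      ≤ C * √((∑ ε : Fin m → ℤˣ, ‖∑ j, (ε j : ℤ) • x j‖ ^ 2) / 2 ^ m)

end

/-! Both classes equal the multiple `2`-summing mappings; cotype of the range gives one inclusion,
cotype of the domains the other.

From `p` to `2` (`multipleSumming_subset_two`): replace a weakly `2`-summable family by all of its
signed sums. By orthogonality of signs and Jensen, these are, on average, weakly `p`-bounded by the
same constant, so multiple `p`-summability bounds the first moment of the decoupled chaos `A(∑ εx,
…, ∑ εx)`. Kahane's inequality raises this to the second moment, and cotype `2` of `F`, used in one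
variable after another, passes to the sum over all indices.

From `2` to `p < 2` (`multipleSumming_two_subset`): in a space of cotype `2` every weakly
`p`-summable family has the form `x_j = √θ_j y_j` with `θ` in the unit ball of `ℓ_{p/(2-p)}` and `y`
weakly `2`-summable (`exists_factorization`); Hölder's inequality then finishes. The factorization
is of Maurey type. Truncating Rademacher sums coordinatewise shows that `f ↦ ∑ f_j x_j` is
`2`-concave with a constant depending only on the cotype constant (`isTwoConcave_of_cotype`), and a
minimax argument turns `2`-concavity into one weight valid for all `f`
(`exists_weight_of_isTwoConcave`). -/

open scoped BigOperators

/-! ### Minimax -/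

/-- **Ky Fan's lemma** for affine functionals: a family of affine inequalities which is solvable in a
compact convex set after taking any finite nonnegative combination has a common solution. -/
theorem exists_forall_le_of_isCompact_convex {ι I : Type*} [Fintype ι] {Θ : Set (ι → ℝ)}
    (hne : Θ.Nonempty) (hconv : Convex ℝ Θ) (hcomp : IsCompact Θ) (u : I → ι → ℝ) (b : I → ℝ)
    (h : ∀ (s : Finset I) (w : s → ℝ), (∀ i, 0 ≤ w i) →
      ∃ θ ∈ Θ, ∑ i, w i * b i ≤ ∑ i, w i * ∑ j, θ j * u i j) :
    ∃ θ ∈ Θ, ∀ i, b i ≤ ∑ j, θ j * u i j := by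
  have hcl : ∀ i, IsClosed {θ : ι → ℝ | b i ≤ ∑ j, θ j * u i j} := fun i =>
    isClosed_le continuous_const (by fun_prop)
  have key : (Θ ∩ ⋂ i, {θ : ι → ℝ | b i ≤ ∑ j, θ j * u i j}).Nonempty := by
    classical
    -- Compactness reduces to finitely many inequalities. For these, a saddle point of the weighted
    -- defect `f` over `Θ` and the simplex gives `θ`: its defect at each vertex is at most `f θ' w ≤
    -- 0`.
    refine hcomp.inter_iInter_nonempty _ hcl fun s => ?_
    rcases s.eq_empty_or_nonempty with rfl | hs
    · simpa using hne
    have : Nonempty s := hs.to_subtype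
    let f : (ι → ℝ) → (s → ℝ) → ℝ := fun θ w => ∑ i, w i * (b i - ∑ j, θ j * u i j)
    obtain ⟨θ, hθ, w, hw, hsad⟩ := Sion.exists_isSaddlePointOn (X := Θ) (Y := stdSimplex ℝ s)
      (f := f) hne hconv hcomp
      (fun y _ => (by fun_prop : Continuous fun x => f x y).lowerSemicontinuous.lowerSemicontinuousOn _)
      (fun y _ => by
        refine ConvexOn.quasiconvexOn ⟨hconv, fun x _ x' _ a c _ _ hac => le_of_eq ?_⟩
        simp only [f, smul_eq_mul, Finset.mul_sum, ← Finset.sum_add_distrib, Pi.add_apply,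
          Pi.smul_apply]
        refine Finset.sum_congr rfl fun i _ => ?_
        have : ∑ j, (a * x j + c * x' j) * u i j
            = a * ∑ j, x j * u i j + c * ∑ j, x' j * u i j := by
          simp only [Finset.mul_sum, ← Finset.sum_add_distrib]
          exact Finset.sum_congr rfl fun j _ => by ring
        rw [this]
        linear_combination (-(y i * b i)) * hac)
      (convex_stdSimplex ℝ s) ⟨_, single_mem_stdSimplex ℝ (Classical.arbitrary s)⟩
      (isCompact_stdSimplex ℝ s)
      (fun x _ => (by fun_prop : Continuous fun y => f x y).upperSemicontinuous.upperSemicontinuousOn _)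
      (fun x _ => by
        refine ConcaveOn.quasiconcaveOn ⟨convex_stdSimplex ℝ s, fun y _ y' _ a c _ _ hac => le_of_eq ?_⟩
        simp only [f, smul_eq_mul, Finset.mul_sum, ← Finset.sum_add_distrib, Pi.add_apply,
          Pi.smul_apply]
        exact Finset.sum_congr rfl fun i _ => by ring)
    obtain ⟨θ', hθ', hle⟩ := h s w hw.1
    refine ⟨θ, hθ, Set.mem_iInter₂.2 fun i hi => ?_⟩
    have h1 := hsad θ' hθ' _ (single_mem_stdSimplex ℝ (⟨i, hi⟩ : s))
    have h2 : f θ' w ≤ 0 := by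
      simp only [f, mul_sub, Finset.sum_sub_distrib]; linarith
    have h3 : f θ (Pi.single ⟨i, hi⟩ 1) = b i - ∑ j, θ j * u i j := by
      simp [f, Pi.single_apply, ite_mul]
    simp only [Set.mem_ofPred_eq]
    linarith
  obtain ⟨θ, hθ, hθ'⟩ := key
  exact ⟨θ, hθ, fun i => Set.mem_iInter.1 hθ' i⟩

/-! ### Fourier analysis on the discrete cube -/

section Walsh

variable {ι : Type*} [Fintype ι]

theorem sum_prod_units_mul (ε δ : ι → ℤˣ) :
    ∑ A : Finset ι, (∏ i ∈ A, ((ε i : ℤ) : ℝ)) * ∏ i ∈ A, ((δ i : ℤ) : ℝ)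
      = if ε = δ then 2 ^ Fintype.card ι else 0 := by
  have h1 := Finset.prod_one_add (f := fun i => ((ε i : ℤ) : ℝ) * ((δ i : ℤ) : ℝ)) Finset.univ
  simp only [Finset.powerset_univ, Finset.prod_mul_distrib] at h1
  rw [← h1]
  split_ifs with h
  · subst h
    have : ∀ i, (1 : ℝ) + ((ε i : ℤ) : ℝ) * ((ε i : ℤ) : ℝ) = 2 := fun i => by
      rcases Int.units_eq_one_or (ε i) with h | h <;> simp [h] <;> norm_num
    simp [this]
  · obtain ⟨i, hi⟩ := Function.ne_iff.1 h
    refine Finset.prod_eq_zero (Finset.mem_univ i) ?_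
    rcases Int.units_eq_one_or (ε i) with h | h <;>
    rcases Int.units_eq_one_or (δ i) with h' | h' <;> simp_all

variable [DecidableEq ι]

/-- The Walsh coefficients of a function on the discrete cube. -/
noncomputable def walshCoeff (h : (ι → ℤˣ) → ℝ) (A : Finset ι) : ℝ :=
  𝔼 ε, h ε * ∏ i ∈ A, ((ε i : ℤ) : ℝ)

/-- Parseval's identity on the discrete cube. -/
theorem sum_walshCoeff_mul (h g : (ι → ℤˣ) → ℝ) :
    ∑ A, walshCoeff h A * walshCoeff g A = 𝔼 ε, h ε * g ε := by
  have hc : (Fintype.card (ι → ℤˣ) : ℝ) = 2 ^ Fintype.card ι := by simp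
  have h1 : ∀ ε δ, ∑ A : Finset ι, h ε * (∏ i ∈ A, ((ε i : ℤ) : ℝ)) *
      (g δ * ∏ i ∈ A, ((δ i : ℤ) : ℝ)) = h ε * g δ * if ε = δ then 2 ^ Fintype.card ι else 0 :=
    fun ε δ => by
      rw [← sum_prod_units_mul, Finset.mul_sum]
      exact Finset.sum_congr rfl fun A _ => by ring
  simp only [walshCoeff, Finset.expect_mul_expect, ← Finset.expect_sum_comm, h1]
  refine Finset.expect_congr rfl fun ε _ => ?_
  rw [Fintype.expect_eq_sum_div_card, hc]
  simp

/-- The reflection of the discrete cube in the `i`-th coordinate. -/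
def signFlip (i : ι) (ε : ι → ℤˣ) : ι → ℤˣ := ε * Pi.mulSingle i (-1)

theorem walshCoeff_comp_signFlip (h : (ι → ℤˣ) → ℝ) (i : ι) (A : Finset ι) :
    walshCoeff (fun ε => h (signFlip i ε)) A = (if i ∈ A then -1 else 1) * walshCoeff h A := by
  rw [walshCoeff, walshCoeff, Finset.mul_expect]
  refine Fintype.expect_equiv (Equiv.mulRight (Pi.mulSingle i (-1))) _ _ fun ε => ?_
  have h1 : ∏ j ∈ A, (((Pi.mulSingle i (-1) : ι → ℤˣ) j : ℤ) : ℝ) = if i ∈ A then -1 else 1 := by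
    rw [← Finset.prod_ite_eq' A i (fun _ => (-1 : ℝ))]
    refine Finset.prod_congr rfl fun j _ => ?_
    by_cases hj : j = i
    · subst hj; simp
    · simp [hj]
  simp only [Equiv.coe_mulRight, signFlip, Pi.mul_apply, Units.val_mul, Int.cast_mul,
    Finset.prod_mul_distrib, h1]
  split_ifs <;> ring

theorem walshCoeff_eq_zero_of_even {h : (ι → ℤˣ) → ℝ} (heven : ∀ ε, h (-ε) = h ε) {A : Finset ι}
    (hA : A.card = 1) : walshCoeff h A = 0 := by
  have : walshCoeff h A = - walshCoeff h A := by
    conv_lhs => rw [walshCoeff]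
    rw [walshCoeff, ← Finset.expect_neg_distrib]
    refine Fintype.expect_equiv (Equiv.neg _) _ _ fun ε => ?_
    obtain ⟨i, rfl⟩ := Finset.card_eq_one.1 hA
    simp [heven]
  linarith

/-- The Latała–Oleszkiewicz argument for the Khintchine–Kahane inequality. -/
theorem expect_sq_le_two_mul_sq_expect {h : (ι → ℤˣ) → ℝ} (h0 : ∀ ε, 0 ≤ h ε)
    (heven : ∀ ε, h (-ε) = h ε)
    (hflip : ∀ ε, (Fintype.card ι - 2 : ℝ) * h ε ≤ ∑ i, h (signFlip i ε)) :
    𝔼 ε, h ε ^ 2 ≤ 2 * (𝔼 ε, h ε) ^ 2 := by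
  have hP : 𝔼 ε, h ε ^ 2 = ∑ A, walshCoeff h A ^ 2 := by
    simp only [sq, sum_walshCoeff_mul]
  have hE : walshCoeff h ∅ = 𝔼 ε, h ε := by simp [walshCoeff]
  have hN : 𝔼 ε, h ε * ∑ i, h (signFlip i ε)
      = ∑ A : Finset ι, (Fintype.card ι - 2 * A.card : ℝ) * walshCoeff h A ^ 2 := by
    simp only [Finset.mul_sum, Finset.expect_sum_comm, ← sum_walshCoeff_mul,
      walshCoeff_comp_signFlip]
    rw [Finset.sum_comm]
    refine Finset.sum_congr rfl fun A _ => ?_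
    have : ∑ i, (if i ∈ A then (-1 : ℝ) else 1) = Fintype.card ι - 2 * A.card := by
      have : ∀ i, (if i ∈ A then (-1 : ℝ) else 1) = 1 - if i ∈ A then 2 else 0 := fun i => by
        split_ifs <;> norm_num
      simp [this, Finset.sum_sub_distrib]
      ring
    rw [← this, Finset.sum_mul]
    exact Finset.sum_congr rfl fun i _ => by ring
  have h1 : (Fintype.card ι - 2 : ℝ) * 𝔼 ε, h ε ^ 2 ≤ 𝔼 ε, h ε * ∑ i, h (signFlip i ε) := by
    rw [Finset.mul_expect]
    refine Finset.expect_le_expect fun ε _ => ?_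
    nlinarith [mul_le_mul_of_nonneg_left (hflip ε) (h0 ε)]
  rw [hN, hP, Finset.mul_sum] at h1
  -- Level `0` has weight `-2`, level `1` vanishes by evenness, and every higher level has weight at
  -- least `2`. Hence the energy above level `0` is at most that of the mean, which is the constant
  -- `2`.
  have h2 : ∑ A : Finset ι, (2 * (A.card : ℝ) - 2) * walshCoeff h A ^ 2 ≤ 0 := by
    have := Finset.sum_sub_distrib (s := Finset.univ)
      (fun A : Finset ι => (Fintype.card ι - 2 : ℝ) * walshCoeff h A ^ 2)
      (fun A => (Fintype.card ι - 2 * A.card : ℝ) * walshCoeff h A ^ 2)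
    have h3 : ∑ A : Finset ι, (2 * (A.card : ℝ) - 2) * walshCoeff h A ^ 2
      = ∑ A : Finset ι, ((Fintype.card ι - 2 : ℝ) * walshCoeff h A ^ 2 -
        (Fintype.card ι - 2 * A.card : ℝ) * walshCoeff h A ^ 2) :=
      Finset.sum_congr rfl fun A _ => by ring
    linarith
  have h4 : ∑ A : Finset ι, (walshCoeff h A ^ 2 - if A = ∅ then 2 * walshCoeff h A ^ 2 else 0)
      ≤ ∑ A : Finset ι, (2 * (A.card : ℝ) - 2) * walshCoeff h A ^ 2 * (1 / 2) := by
    refine Finset.sum_le_sum fun A _ => ?_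
    rcases Nat.lt_or_ge A.card 2 with hA | hA
    · rcases Nat.lt_or_ge A.card 1 with hA' | hA'
      · have : A = ∅ := by simpa using hA'
        simp [this]
        linarith
      · have hA1 : A.card = 1 := by omega
        have hA0 : A ≠ ∅ := by rintro rfl; simp at hA'
        simp [walshCoeff_eq_zero_of_even heven hA1, hA1, hA0]
    · have hA0 : A ≠ ∅ := by rintro rfl; simp at hA
      have : (2 : ℝ) ≤ A.card := by exact_mod_cast hA
      simp only [hA0, if_false]
      nlinarith [sq_nonneg (walshCoeff h A)]
  rw [← Finset.sum_mul, Finset.sum_sub_distrib] at h4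
  simp only [Finset.sum_ite_eq', Finset.mem_univ, if_true] at h4
  rw [hP, ← hE]
  linarith

end Walsh

/-! ### Rademacher sums and Kahane's inequality -/

/-- The signed sum `∑ εᵢ xᵢ`. -/
def signedSum {ι E : Type*} [Fintype ι] [AddCommGroup E] (x : ι → E) (ε : ι → ℤˣ) : E :=
  ∑ i, (ε i : ℤ) • x i

theorem signedSum_cons {E : Type*} [AddCommGroup E] {m : ℕ} (x : Fin (m + 1) → E) (e : ℤˣ)
    (ε : Fin m → ℤˣ) :
    signedSum x (Fin.cons e ε : Fin (m + 1) → ℤˣ) = (e : ℤ) • x 0 + signedSum (fun i => x i.succ) ε := by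
  simp [signedSum, Fin.sum_univ_succ]

theorem map_signedSum {ι E F G : Type*} [Fintype ι] [AddCommGroup E] [AddCommGroup F]
    [FunLike G E F] [AddMonoidHomClass G E F] (f : G) (x : ι → E) (ε : ι → ℤˣ) :
    f (signedSum x ε) = signedSum (fun i => f (x i)) ε := by
  simp [signedSum, map_sum, map_zsmul]

/-- The **Khintchine–Kahane inequality** between the first and the second moment. -/
theorem Seminorm.expect_sq_signedSum_le {𝕜 E ι : Type*} [RCLike 𝕜] [AddCommGroup E] [Module 𝕜 E]
    [Fintype ι] [DecidableEq ι] (q : Seminorm 𝕜 E) (x : ι → E) :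
    𝔼 ε, q (signedSum x ε) ^ 2 ≤ 2 * (𝔼 ε, q (signedSum x ε)) ^ 2 := by
  refine expect_sq_le_two_mul_sq_expect (fun ε => apply_nonneg q _) (fun ε => ?_) fun ε => ?_
  · have : signedSum x (-ε) = - signedSum x ε := by simp [signedSum]
    rw [this, map_neg_eq_map]
  · have hflip : ∀ i, signedSum x (signFlip i ε) = signedSum x ε - (2 * (ε i : ℤ)) • x i := fun i => by
      rw [eq_sub_iff_add_eq, signedSum, signedSum, ← Finset.add_sum_erase _ _ (Finset.mem_univ i),
        ← Finset.add_sum_erase _ (fun i => (ε i : ℤ) • x i) (Finset.mem_univ i)]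
      have : ∑ j ∈ Finset.univ.erase i, ((signFlip i ε j : ℤˣ) : ℤ) • x j
          = ∑ j ∈ Finset.univ.erase i, (ε j : ℤ) • x j :=
        Finset.sum_congr rfl fun j hj => by simp [signFlip, Finset.ne_of_mem_erase hj]
      rw [this]
      simp only [signFlip, Pi.mul_apply, Pi.mulSingle_eq_same, mul_neg, mul_one, Units.val_neg]
      module
    -- Each `x i` keeps its sign in all flips but one, so the flips add up to `card ι - 2` copies;
    -- the triangle inequality then gives the flip condition.
    have hsum : ∑ i, signedSum x (signFlip i ε) = ((Fintype.card ι : 𝕜) - 2) • signedSum x ε := by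
      simp only [hflip, Finset.sum_sub_distrib, mul_smul, ← Finset.smul_sum]
      simp [signedSum, sub_smul, Nat.cast_smul_eq_nsmul, ofNat_smul_eq_nsmul]
    calc (Fintype.card ι - 2 : ℝ) * q (signedSum x ε)
        ≤ ‖(Fintype.card ι : 𝕜) - 2‖ * q (signedSum x ε) := by
          gcongr
          have := RCLike.re_le_norm ((Fintype.card ι : 𝕜) - 2)
          simpa using this
      _ = q (∑ i, signedSum x (signFlip i ε)) := by rw [hsum, map_smul_eq_mul]
      _ ≤ _ := Finset.le_sum_of_subadditive q (map_zero q).le (map_add_le_add q) _ _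

theorem Fin.expect_univ_pi_succ {n : ℕ} {α : Fin (n + 1) → Type*} [∀ k, Fintype (α k)]
    (f : (∀ k, α k) → ℝ) :
    𝔼 a, f a = 𝔼 a : α 0, 𝔼 b : (∀ k : Fin n, α k.succ), f (Fin.cons a b) := by
  rw [← Finset.expect_product', Finset.univ_product_univ]
  exact (Fintype.expect_equiv (Fin.consEquiv α) _ _ fun _ => rfl).symm

theorem Fin.sum_univ_pi_succ {n : ℕ} {α : Fin (n + 1) → Type*} [∀ k, Fintype (α k)]
    (f : (∀ k, α k) → ℝ) :
    ∑ a, f a = ∑ a : α 0, ∑ b : (∀ k : Fin n, α k.succ), f (Fin.cons a b) := by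
  rw [← Fintype.sum_prod_type']
  exact (Fintype.sum_equiv (Fin.consEquiv α) _ _ fun _ => rfl).symm

theorem Fin.map_cons_dep {n : ℕ} {α β : Fin (n + 1) → Type*} (g : ∀ k, α k → β k) (a : α 0)
    (b : ∀ k : Fin n, α k.succ) :
    (fun k => g k ((Fin.cons a b : ∀ k, α k) k)) = Fin.cons (g 0 a) fun k => g k.succ (b k) := by
  ext k
  refine Fin.cases ?_ (fun k => ?_) k <;> simp

/-! ### Decoupled Rademacher chaoses -/

section Multilinear

variable {𝕜 : Type*} [RCLike 𝕜] {F : Type*} [NormedAddCommGroup F] [NormedSpace 𝕜 F]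

/-- The Khintchine–Kahane inequality for decoupled Rademacher chaoses. -/
theorem MultilinearMap.expect_norm_sq_le {n : ℕ} {E : Fin n → Type*} [∀ k, AddCommGroup (E k)]
    [∀ k, Module 𝕜 (E k)] (A : MultilinearMap 𝕜 E F) (m : Fin n → ℕ) (x : ∀ k, Fin (m k) → E k) :
    𝔼 ε : ∀ k, Fin (m k) → ℤˣ, ‖A fun k => signedSum (x k) (ε k)‖ ^ 2
      ≤ 2 ^ n * (𝔼 ε : ∀ k, Fin (m k) → ℤˣ, ‖A fun k => signedSum (x k) (ε k)‖) ^ 2 := by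
  induction n with
  | zero => simp [Subsingleton.elim (fun k => signedSum (x k) _) (0 : ∀ k, E k)]
  | succ n ih =>
    simp only [Fin.expect_univ_pi_succ, Fin.map_cons_dep fun k => signedSum (x k)]
    -- Averaging the norm over the remaining signs gives a seminorm in the first variable, which is
    -- why Kahane's inequality is needed for seminorms.
    let q : Seminorm 𝕜 (E 0) := Seminorm.of
      (fun v => 𝔼 ε : ∀ k : Fin n, Fin (m k.succ) → ℤˣ,
        ‖A (Fin.cons v fun k => signedSum (x k.succ) (ε k))‖)
      (fun v w => by
        rw [← Finset.expect_add_distrib]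
        refine Finset.expect_le_expect fun ε _ => ?_
        rw [A.cons_add]
        exact norm_add_le _ _)
      (fun c v => by
        simp only [A.cons_smul, norm_smul, Finset.mul_expect])
    have hq : ∀ v, 𝔼 ε : ∀ k : Fin n, Fin (m k.succ) → ℤˣ,
        ‖A (Fin.cons v fun k => signedSum (x k.succ) (ε k))‖ = q v := fun v => rfl
    have h1 : ∀ v, 𝔼 ε : ∀ k : Fin n, Fin (m k.succ) → ℤˣ,
        ‖A (Fin.cons v fun k => signedSum (x k.succ) (ε k))‖ ^ 2 ≤ 2 ^ n * q v ^ 2 := fun v =>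
      ih (A.curryLeft v) (fun k => m k.succ) fun k => x k.succ
    simp only [hq]
    calc _ ≤ 𝔼 ε, 2 ^ n * q (signedSum (x 0) ε) ^ 2 := Finset.expect_le_expect fun ε _ => h1 _
      _ = 2 ^ n * 𝔼 ε, q (signedSum (x 0) ε) ^ 2 := by rw [Finset.mul_expect]
      _ ≤ 2 ^ n * (2 * (𝔼 ε, q (signedSum (x 0) ε)) ^ 2) := by
        gcongr
        exact q.expect_sq_signedSum_le _
      _ = _ := by ring

/-- The cotype `2` inequality for decoupled Rademacher chaoses. -/
theorem MultilinearMap.sum_norm_sq_le {n : ℕ} {E : Fin n → Type*} [∀ k, AddCommGroup (E k)]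
    [∀ k, Module 𝕜 (E k)] (A : MultilinearMap 𝕜 E F) (m : Fin n → ℕ) (x : ∀ k, Fin (m k) → E k)
    {D : ℝ} (hD : 0 ≤ D)
    (hF : ∀ (m : ℕ) (y : Fin m → F), ∑ j, ‖y j‖ ^ 2 ≤ D * 𝔼 ε, ‖signedSum y ε‖ ^ 2) :
    ∑ j : ∀ k, Fin (m k), ‖A fun k => x k (j k)‖ ^ 2
      ≤ D ^ n * 𝔼 ε : ∀ k, Fin (m k) → ℤˣ, ‖A fun k => signedSum (x k) (ε k)‖ ^ 2 := by
  induction n with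
  | zero =>
    simp [Subsingleton.elim (fun k => signedSum (x k) _) (0 : ∀ k, E k),
      Subsingleton.elim (fun k => x k _) (0 : ∀ k, E k)]
  | succ n ih =>
    simp only [Fin.expect_univ_pi_succ, Fin.map_cons_dep fun k => signedSum (x k)]
    simp only [Fin.sum_univ_pi_succ, Fin.map_cons_dep x]
    have h1 : ∀ v, ∑ j : ∀ k : Fin n, Fin (m k.succ), ‖A (Fin.cons v fun k => x k.succ (j k))‖ ^ 2
        ≤ D ^ n * 𝔼 ε : ∀ k : Fin n, Fin (m k.succ) → ℤˣ,
          ‖A (Fin.cons v fun k => signedSum (x k.succ) (ε k))‖ ^ 2 := fun v =>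
      ih (A.curryLeft v) (fun k => m k.succ) fun k => x k.succ
    calc _ ≤ ∑ i, D ^ n * 𝔼 ε : ∀ k : Fin n, Fin (m k.succ) → ℤˣ,
          ‖A (Fin.cons (x 0 i) fun k => signedSum (x k.succ) (ε k))‖ ^ 2 :=
          Finset.sum_le_sum fun i _ => h1 _
      _ = D ^ n * 𝔼 ε : ∀ k : Fin n, Fin (m k.succ) → ℤˣ, ∑ i,
          ‖A (Fin.cons (x 0 i) fun k => signedSum (x k.succ) (ε k))‖ ^ 2 := by
        rw [← Finset.mul_sum, Finset.expect_sum_comm]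
      _ ≤ D ^ n * 𝔼 ε : ∀ k : Fin n, Fin (m k.succ) → ℤˣ, D * 𝔼 δ,
          ‖A (Fin.cons (signedSum (x 0) δ) fun k => signedSum (x k.succ) (ε k))‖ ^ 2 := by
        gcongr with ε _
        have := hF _ fun i => A (Fin.cons (x 0 i) fun k => signedSum (x k.succ) (ε k))
        refine this.trans_eq ?_
        congr 2 with δ
        congr 2
        exact (map_signedSum (AddMonoidHom.mk' (fun v : E 0 =>
          A (Fin.cons v fun k => signedSum (x k.succ) (ε k))) fun v w => A.cons_add _ v w)
          (x 0) δ).symm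
      _ = _ := by
        rw [← Finset.mul_expect, Finset.expect_comm]
        ring

end Multilinear

/-! ### Second and fourth moments of scalar Rademacher sums -/

section FourthMoment

variable {𝕜 : Type*} [RCLike 𝕜]

theorem expect_norm_sq_signedSum {m : ℕ} (a : Fin m → 𝕜) :
    𝔼 ε, ‖signedSum a ε‖ ^ 2 = ∑ i, ‖a i‖ ^ 2 := by
  induction m with
  | zero => simp [signedSum]
  | succ m ih =>
    rw [Fin.expect_univ_pi_succ, Fin.sum_univ_succ, ← ih, Finset.expect_comm]
    have : ∀ ε, 𝔼 e : ℤˣ, ‖signedSum a (Fin.cons e ε : Fin (m + 1) → ℤˣ)‖ ^ 2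
        = ‖a 0‖ ^ 2 + ‖signedSum (fun i => a i.succ) ε‖ ^ 2 := fun ε => by
      simp only [signedSum_cons, Fintype.expect_eq_sum_div_card]
      have h := parallelogram_law_with_norm 𝕜 (signedSum (fun i => a i.succ) ε) (a 0)
      simp [neg_add_eq_sub, add_comm (a 0)]
      linarith
    simp only [this, Finset.expect_add_distrib]
    simp

theorem expect_norm_pow_four_signedSum_le {m : ℕ} (a : Fin m → 𝕜) :
    𝔼 ε, ‖signedSum a ε‖ ^ 4 ≤ 3 * (∑ i, ‖a i‖ ^ 2) ^ 2 := by
  induction m with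
  | zero => simp [signedSum]
  | succ m ih =>
    rw [Fin.expect_univ_pi_succ, Fin.sum_univ_succ, Finset.expect_comm]
    have : ∀ ε, 𝔼 e : ℤˣ, ‖signedSum a (Fin.cons e ε : Fin (m + 1) → ℤˣ)‖ ^ 4
        ≤ ‖a 0‖ ^ 4 + 6 * ‖a 0‖ ^ 2 * ‖signedSum (fun i => a i.succ) ε‖ ^ 2
          + ‖signedSum (fun i => a i.succ) ε‖ ^ 4 := fun ε => by
      simp only [signedSum_cons, Fintype.expect_eq_sum_div_card]
      set s := signedSum (fun i => a i.succ) ε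
      have h1 := norm_add_sq (𝕜 := 𝕜) s (a 0)
      have h2 := norm_sub_sq (𝕜 := 𝕜) s (a 0)
      have h3 := abs_le.1 ((RCLike.abs_re_le_norm _).trans (norm_inner_le_norm (𝕜 := 𝕜) s (a 0)))
      have h5 : RCLike.re (inner 𝕜 s (a 0)) ^ 2 ≤ (‖s‖ * ‖a 0‖) ^ 2 := sq_le_sq' h3.1 h3.2
      have h4 : ∀ v : 𝕜, ‖v‖ ^ 4 = (‖v‖ ^ 2) ^ 2 := fun v => by ring
      have h6 : ‖s + a 0‖ ^ 4 + ‖s - a 0‖ ^ 4 ≤ 2 * (‖a 0‖ ^ 4 + 6 * ‖a 0‖ ^ 2 * ‖s‖ ^ 2 + ‖s‖ ^ 4) := by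
        rw [h4 (s + a 0), h4 (s - a 0), h1, h2]
        nlinarith
      simp [neg_add_eq_sub, add_comm (a 0)]
      linarith
    calc _ ≤ 𝔼 ε, (‖a 0‖ ^ 4 + 6 * ‖a 0‖ ^ 2 * ‖signedSum (fun i => a i.succ) ε‖ ^ 2
          + ‖signedSum (fun i => a i.succ) ε‖ ^ 4) := Finset.expect_le_expect fun ε _ => this ε
      _ = ‖a 0‖ ^ 4 + 6 * ‖a 0‖ ^ 2 * ∑ i : Fin m, ‖a i.succ‖ ^ 2
          + 𝔼 ε, ‖signedSum (fun i : Fin m => a i.succ) ε‖ ^ 4 := by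
        rw [Finset.expect_add_distrib, Finset.expect_add_distrib, ← Finset.mul_expect,
          expect_norm_sq_signedSum]
        simp
      _ ≤ _ := by
        nlinarith [ih fun i => a i.succ, sq_nonneg (‖a 0‖ ^ 2)]

end FourthMoment

/-! ### Cotype `2` in squared form -/

section Cotype

variable {E : Type*} [NormedAddCommGroup E]

theorem HasCotype.exists_sum_sq_le (h : HasCotype 2 E) : ∃ D : ℝ, 0 < D ∧
    ∀ (m : ℕ) (x : Fin m → E), ∑ j, ‖x j‖ ^ 2 ≤ D * 𝔼 ε, ‖signedSum x ε‖ ^ 2 := by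
  obtain ⟨C, hC, h⟩ := h
  refine ⟨C ^ 2 + 1, by positivity, fun m x => ?_⟩
  have h1 := h m x
  have hs : ∑ j, ‖x j‖ ^ (2 : ℝ) = ∑ j, ‖x j‖ ^ 2 := by simp
  have he : (∑ ε : Fin m → ℤˣ, ‖∑ j, (ε j : ℤ) • x j‖ ^ 2) / 2 ^ m = 𝔼 ε, ‖signedSum x ε‖ ^ 2 := by
    rw [Fintype.expect_eq_sum_div_card]; simp [signedSum]
  have he0 : 0 ≤ 𝔼 ε, ‖signedSum x ε‖ ^ 2 := Finset.expect_nonneg fun _ _ => by positivity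
  rw [hs, he, ← Real.sqrt_eq_rpow] at h1
  have h2 := pow_le_pow_left₀ (Real.sqrt_nonneg _) h1 2
  rw [mul_pow, Real.sq_sqrt (by positivity), Real.sq_sqrt he0] at h2
  nlinarith

end Cotype

theorem Real.rpow_expect_le {ι : Type*} [Fintype ι] [Nonempty ι] {f : ι → ℝ} (hf : ∀ i, 0 ≤ f i)
    {p : ℝ} (hp : 1 ≤ p) : (𝔼 i, f i) ^ p ≤ 𝔼 i, f i ^ p := by
  have h := Real.rpow_arith_mean_le_arith_mean_rpow Finset.univ
    (fun _ : ι => (Fintype.card ι : ℝ)⁻¹) f (fun _ _ => by positivity) (by simp)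
    (fun i _ => hf i) hp
  simpa only [Fintype.expect_eq_sum_div_card, div_eq_inv_mul, Finset.mul_sum] using h

/-! ### Weak norms and multiple summability through upper bounds -/

section WeakNorm

variable {𝕜 : Type*} [RCLike 𝕜] {E : Type*} [NormedAddCommGroup E] [NormedSpace 𝕜 E] {p : ℝ}

theorem weakNorm_nonneg {m : ℕ} (x : Fin m → E) : 0 ≤ weakNorm 𝕜 p x :=
  Real.iSup_nonneg fun _ => by positivity

theorem sum_norm_rpow_le_weakNorm (hp : 1 ≤ p) {m : ℕ} (x : Fin m → E) {φ : StrongDual 𝕜 E}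
    (hφ : ‖φ‖ ≤ 1) : ∑ j, ‖φ (x j)‖ ^ p ≤ weakNorm 𝕜 p x ^ p := by
  have h := le_ciSup (weakNorm_bddAbove 𝕜 hp x) ⟨φ, by simpa using hφ⟩
  have h0 : 0 ≤ ∑ j, ‖φ (x j)‖ ^ p := by positivity
  change (∑ j, ‖φ (x j)‖ ^ p) ^ (1 / p) ≤ weakNorm 𝕜 p x at h
  rw [one_div] at h
  exact (Real.rpow_inv_le_iff_of_pos h0 (weakNorm_nonneg x) (by linarith)).1 h

theorem weakNorm_le (hp : 1 ≤ p) {m : ℕ} {x : Fin m → E} {W : ℝ} (hW : 0 ≤ W)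
    (h : ∀ φ : StrongDual 𝕜 E, ‖φ‖ ≤ 1 → ∑ j, ‖φ (x j)‖ ^ p ≤ W ^ p) : weakNorm 𝕜 p x ≤ W := by
  have : Nonempty (Metric.closedBall (0 : StrongDual 𝕜 E) 1) := ⟨0, by simp⟩
  refine ciSup_le fun φ => ?_
  rw [one_div]
  exact (Real.rpow_inv_le_iff_of_pos (by positivity) hW (by linarith)).2
    (h φ (mem_closedBall_zero_iff.1 φ.2))

end WeakNorm

section Multiple

variable {𝕜 : Type*} [RCLike 𝕜] {n : ℕ} {E : Fin n → Type*} [∀ k, NormedAddCommGroup (E k)]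
  [∀ k, NormedSpace 𝕜 (E k)] {F : Type*} [NormedAddCommGroup F] [NormedSpace 𝕜 F]
  {A : ContinuousMultilinearMap 𝕜 E F} {p : ℝ}

/-- Arbitrary finite index types are allowed because the lemma is applied to families indexed by
sign vectors. -/
theorem exists_le_of_mem_multipleSumming (hp : 1 ≤ p)
    (hA : A ∈ multipleSumming 𝕜 p (fun _ => p) E F) : ∃ C : ℝ, 0 ≤ C ∧
      ∀ (ι : Fin n → Type) [∀ k, Fintype (ι k)] (x : ∀ k, ι k → E k) (W : Fin n → ℝ),
        (∀ k, 0 ≤ W k) →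
        (∀ k, ∀ φ : StrongDual 𝕜 (E k), ‖φ‖ ≤ 1 → ∑ j, ‖φ (x k j)‖ ^ p ≤ W k ^ p) →
        ∑ j : ∀ k, ι k, ‖A fun k => x k (j k)‖ ^ p ≤ (C * ∏ k, W k) ^ p := by
  obtain ⟨C, hC, h⟩ := hA
  refine ⟨C, hC, fun ι _ x W hW hx => ?_⟩
  let e : ∀ k, Fin (Fintype.card (ι k)) ≃ ι k := fun k => (Fintype.equivFin (ι k)).symm
  have h1 := h (fun k => Fintype.card (ι k)) fun k j => x k (e k j)
  have h2 : ∏ k, weakNorm 𝕜 p (fun j => x k (e k j)) ≤ ∏ k, W k := by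
    refine Finset.prod_le_prod (fun k _ => weakNorm_nonneg _) fun k _ =>
      weakNorm_le hp (hW k) fun φ hφ => ?_
    refine le_of_eq_of_le ?_ (hx k φ hφ)
    exact Fintype.sum_equiv (e k) _ _ fun _ => rfl
  have h3 : ∑ j : ∀ k, Fin (Fintype.card (ι k)), ‖A fun k => x k (e k (j k))‖ ^ p
      = ∑ j : ∀ k, ι k, ‖A fun k => x k (j k)‖ ^ p :=
    Fintype.sum_equiv (Equiv.piCongrRight e) _ _ fun _ => rfl
  rw [h3, one_div] at h1
  refine (Real.rpow_inv_le_iff_of_pos (by positivity) ?_ (by linarith)).1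
    (h1.trans (mul_le_mul_of_nonneg_left h2 hC))
  exact mul_nonneg hC (Finset.prod_nonneg fun k _ => hW k)

theorem mem_multipleSumming_of_le (hp : 1 ≤ p) {C : ℝ} (hC : 0 ≤ C)
    (h : ∀ (m : Fin n → ℕ) (x : ∀ k, Fin (m k) → E k) (W : Fin n → ℝ), (∀ k, 0 ≤ W k) →
      (∀ k, ∀ φ : StrongDual 𝕜 (E k), ‖φ‖ ≤ 1 → ∑ j, ‖φ (x k j)‖ ^ p ≤ W k ^ p) →
      ∑ j : ∀ k, Fin (m k), ‖A fun k => x k (j k)‖ ^ p ≤ (C * ∏ k, W k) ^ p) :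
    A ∈ multipleSumming 𝕜 p (fun _ => p) E F := by
  refine ⟨C, hC, fun m x => ?_⟩
  rw [one_div]
  refine (Real.rpow_inv_le_iff_of_pos (by positivity) ?_ (by linarith)).2
    (h m x _ (fun k => weakNorm_nonneg (x k)) fun k φ hφ => sum_norm_rpow_le_weakNorm hp _ hφ)
  exact mul_nonneg hC (Finset.prod_nonneg fun k _ => weakNorm_nonneg _)

/-- If the range has cotype `2`, multiple `p`-summing mappings are multiple `2`-summing. -/
theorem multipleSumming_subset_two (hF : HasCotype 2 F) (hp : 1 ≤ p) (hp2 : p ≤ 2) :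
    multipleSumming 𝕜 p (fun _ => p) E F ⊆ multipleSumming 𝕜 2 (fun _ => 2) E F := by
  intro A hA
  obtain ⟨C, hC, h⟩ := exists_le_of_mem_multipleSumming hp hA
  obtain ⟨D, hD, hF⟩ := hF.exists_sum_sq_le
  have hp0 : 0 < p := by linarith
  refine mem_multipleSumming_of_le one_le_two (C := √(D ^ n * 2 ^ n) * C) (by positivity)
    fun m x W hW hx => ?_
  simp only [Real.rpow_ofNat] at hx ⊢
  have hP : 0 ≤ ∏ k, W k := Finset.prod_nonneg fun k _ => hW k
  have key : 𝔼 ε : ∀ k, Fin (m k) → ℤˣ, ‖A fun k => signedSum (x k) (ε k)‖ ≤ C * ∏ k, W k := by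
    have h1 := h (fun k => Fin (m k) → ℤˣ) (fun k => signedSum (x k))
      -- The factor `2 ^ (m k / p)` turns averages over signs into sums; it cancels when the left
      -- side is averaged again.
      (fun k => ((2 : ℝ) ^ m k) ^ (1 / p) * W k) (fun k => mul_nonneg (by positivity) (hW k))
      fun k φ hφ => by
        have h2 : 𝔼 ε, ‖φ (signedSum (x k) ε)‖ ^ 2 ≤ W k ^ 2 := by
          simp only [map_signedSum φ (x k), expect_norm_sq_signedSum]
          exact hx k φ hφ
        have h3 := Real.rpow_expect_le (f := fun ε => ‖φ (signedSum (x k) ε)‖ ^ p)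
          (fun _ => by positivity) (p := 2 / p) (by rwa [le_div_iff₀ hp0, one_mul])
        have h4 : ∀ a : ℝ, 0 ≤ a → (a ^ p) ^ (2 / p) = a ^ 2 := fun a ha => by
          rw [← Real.rpow_mul ha, mul_div_cancel₀ _ hp0.ne', Real.rpow_two]
        have h5 : 𝔼 ε, ‖φ (signedSum (x k) ε)‖ ^ p ≤ W k ^ p := by
          refine (Real.rpow_le_rpow_iff (Finset.expect_nonneg fun _ _ => by positivity)
            (Real.rpow_nonneg (hW k) p) (by positivity : 0 < 2 / p)).1 ?_
          simp only [h4 _ (norm_nonneg _)] at h3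
          rw [h4 _ (hW k)]
          exact h3.trans h2
        rw [Real.mul_rpow (by positivity) (hW k), ← Real.rpow_mul (by positivity),
          one_div_mul_cancel hp0.ne', Real.rpow_one]
        rw [Fintype.expect_eq_sum_div_card, div_le_iff₀ (by positivity)] at h5
        simpa [mul_comm] using h5
    have h6 := Real.rpow_expect_le
      (f := fun ε : ∀ k, Fin (m k) → ℤˣ => ‖A fun k => signedSum (x k) (ε k)‖)
      (fun _ => norm_nonneg _) hp
    refine (Real.rpow_le_rpow_iff (Finset.expect_nonneg fun _ _ => norm_nonneg _)
      (mul_nonneg hC hP) hp0).1 (h6.trans ?_)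
    rw [Fintype.expect_eq_sum_div_card, div_le_iff₀ (by positivity)]
    refine h1.trans_eq ?_
    rw [Finset.prod_mul_distrib, mul_left_comm, Real.mul_rpow (by positivity) (mul_nonneg hC hP),
      mul_comm, ← Real.finsetProd_rpow _ _ fun k _ => by positivity]
    congr 1
    simp only [← Real.rpow_mul (show (0 : ℝ) ≤ 2 ^ _ by positivity), one_div_mul_cancel hp0.ne',
      Real.rpow_one]
    simp [Fintype.card_pi]
  have h2 := A.toMultilinearMap.sum_norm_sq_le m x hD.le hF
  have h3 := A.toMultilinearMap.expect_norm_sq_le m x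
  have h4 : 0 ≤ 𝔼 ε : ∀ k, Fin (m k) → ℤˣ, ‖A fun k => signedSum (x k) (ε k)‖ :=
    Finset.expect_nonneg fun _ _ => norm_nonneg _
  calc _ ≤ D ^ n * _ := h2
    _ ≤ D ^ n * (2 ^ n * _) := by gcongr
    _ ≤ D ^ n * (2 ^ n * (C * ∏ k, W k) ^ 2) := by gcongr; exact key
    _ = _ := by
      rw [mul_assoc (√_), mul_pow (√_), Real.sq_sqrt (by positivity)]
      ring

end Multiple

/-! ### Weights in the unit ball of `ℓ_t` -/

section Weights

variable {ι : Type*} [Fintype ι]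

/-- The positive part of the unit ball of `ℓ_t`. -/
def positiveUnitBall (ι : Type*) [Fintype ι] (t : ℝ) : Set (ι → ℝ) :=
  {θ | (∀ j, 0 ≤ θ j) ∧ ∑ j, θ j ^ t ≤ 1}

variable {t : ℝ}

theorem positiveUnitBall_nonempty (ht : 1 ≤ t) : (positiveUnitBall ι t).Nonempty :=
  ⟨0, fun _ => le_rfl, by simp [Real.zero_rpow (by linarith : t ≠ 0)]⟩

theorem convex_positiveUnitBall (ht : 1 ≤ t) : Convex ℝ (positiveUnitBall ι t) := by
  intro x hx y hy a b ha hb hab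
  refine ⟨fun j => ?_, ?_⟩
  · have := hx.1 j
    have := hy.1 j
    simp only [Pi.add_apply, Pi.smul_apply, smul_eq_mul]
    positivity
  · calc ∑ j, (a • x + b • y) j ^ t ≤ ∑ j, (a * x j ^ t + b * y j ^ t) :=
        Finset.sum_le_sum fun j _ => (convexOn_rpow ht).2 (hx.1 j) (hy.1 j) ha hb hab
      _ = a * ∑ j, x j ^ t + b * ∑ j, y j ^ t := by
        rw [Finset.sum_add_distrib, Finset.mul_sum, Finset.mul_sum]
      _ ≤ a * 1 + b * 1 := by gcongr; exacts [hx.2, hy.2]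
      _ = 1 := by linarith

theorem le_one_of_mem_positiveUnitBall (ht : 1 ≤ t) {θ : ι → ℝ} (hθ : θ ∈ positiveUnitBall ι t)
    (j : ι) : θ j ≤ 1 := by
  have h1 : θ j ^ t ≤ 1 := (Finset.single_le_sum (f := fun j => θ j ^ t)
    (fun i _ => Real.rpow_nonneg (hθ.1 i) t) (Finset.mem_univ j)).trans hθ.2
  by_contra h
  exact absurd h1 (not_le.2 (Real.one_lt_rpow (not_le.1 h) (by linarith)))

theorem isCompact_positiveUnitBall (ht : 1 ≤ t) : IsCompact (positiveUnitBall ι t) := by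
  refine (isCompact_Icc (a := (0 : ι → ℝ)) (b := 1)).of_isClosed_subset ?_ fun θ hθ =>
    ⟨hθ.1, le_one_of_mem_positiveUnitBall ht hθ⟩
  have h1 : IsClosed {θ : ι → ℝ | ∀ j, 0 ≤ θ j} := by
    simp only [Set.ofPred_forall]
    exact isClosed_iInter fun j => isClosed_le continuous_const (continuous_apply j)
  exact h1.inter (isClosed_le (continuous_finsetSum _ fun j _ =>
    (continuous_apply j).rpow_const fun _ => Or.inr (by linarith)) continuous_const)

theorem single_mem_positiveUnitBall [DecidableEq ι] (ht : 1 ≤ t) (j : ι) :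
    Pi.single j 1 ∈ positiveUnitBall ι t := by
  have h0 : t ≠ 0 := by linarith
  refine ⟨fun i => ?_, ?_⟩
  · by_cases h : i = j
    · subst h; simp
    · simp [h]
  · rw [Finset.sum_eq_single j (fun i _ hi => by simp [hi, Real.zero_rpow h0]) (by simp)]
    simp

end Weights

/-! ### `2`-concavity and Maurey factorization -/

section Concave

variable {𝕜 : Type*} [RCLike 𝕜] {E : Type*} [NormedAddCommGroup E] [NormedSpace 𝕜 E]
  {ι : Type*} [Fintype ι] {t p : ℝ} {x : ι → E} {L : ℝ}

/-- The operator `f ↦ ∑ⱼ fⱼ xⱼ` is `2`-concave with constant `√L` with respect to the lattice norm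
`f ↦ sup_θ (∑ⱼ θⱼ |fⱼ|²)^{1/2}`, where `θ` runs over the positive part of the unit ball of `ℓ_t`. -/
def IsTwoConcave (𝕜 : Type*) [RCLike 𝕜] {E : Type*} [NormedAddCommGroup E] [NormedSpace 𝕜 E]
    {ι : Type*} [Fintype ι] (t : ℝ) (x : ι → E) (L : ℝ) : Prop :=
  ∀ (N : ℕ) (f : Fin N → ι → 𝕜) (c : ℝ),
    (∀ θ ∈ positiveUnitBall ι t, ∑ j, θ j * ∑ i, ‖f i j‖ ^ 2 ≤ c) →
    ∑ i, ‖∑ j, f i j • x j‖ ^ 2 ≤ L * c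

theorem IsTwoConcave.sum_le (h : IsTwoConcave 𝕜 t x L) {κ : Type*} [Fintype κ] (f : κ → ι → 𝕜)
    (c : ℝ) (hf : ∀ θ ∈ positiveUnitBall ι t, ∑ j, θ j * ∑ i, ‖f i j‖ ^ 2 ≤ c) :
    ∑ i, ‖∑ j, f i j • x j‖ ^ 2 ≤ L * c := by
  let e := (Fintype.equivFin κ).symm
  rw [← e.sum_comp]
  refine h _ (fun i => f (e i)) c fun θ hθ => ?_
  convert hf θ hθ using 3
  exact e.sum_comp fun i => ‖f i _‖ ^ 2

theorem IsTwoConcave.expect_le (h : IsTwoConcave 𝕜 t x L) {κ : Type*} [Fintype κ] [Nonempty κ]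
    (f : κ → ι → 𝕜) (c : ℝ)
    (hf : ∀ θ ∈ positiveUnitBall ι t, ∑ j, θ j * 𝔼 i, ‖f i j‖ ^ 2 ≤ c) :
    𝔼 i, ‖∑ j, f i j • x j‖ ^ 2 ≤ L * c := by
  have hK : (0 : ℝ) < Fintype.card κ := by positivity
  have h1 := h.sum_le f (c * Fintype.card κ) fun θ hθ => by
    have := hf θ hθ
    simp only [Fintype.expect_eq_sum_div_card, ← mul_div_assoc, ← Finset.sum_div] at this
    rwa [div_le_iff₀ hK] at this
  rw [Fintype.expect_eq_sum_div_card, div_le_iff₀ hK]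
  linarith

theorem IsTwoConcave.sum_weight_mul_le (h : IsTwoConcave 𝕜 t x L) {κ : Type*} [Fintype κ]
    (w : κ → ℝ) (hw : ∀ i, 0 ≤ w i) (f : κ → ι → 𝕜) (c : ℝ)
    (hf : ∀ θ ∈ positiveUnitBall ι t, ∑ j, θ j * ∑ i, w i * ‖f i j‖ ^ 2 ≤ c) :
    ∑ i, w i * ‖∑ j, f i j • x j‖ ^ 2 ≤ L * c := by
  have hs : ∀ i, ‖((√(w i) : ℝ) : 𝕜)‖ ^ 2 = w i := fun i => by
    rw [RCLike.norm_ofReal, sq_abs, Real.sq_sqrt (hw i)]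
  have h1 := h.sum_le (fun i j => ((√(w i) : ℝ) : 𝕜) * f i j) c (by
    simpa only [norm_mul, mul_pow, hs] using hf)
  simpa only [mul_smul, ← Finset.smul_sum, norm_smul, mul_pow, hs] using h1

/-- Supplies some finite constant, however bad, from which the iteration of `IsTwoConcave.improve`
can start. -/
theorem isTwoConcave_crude (ht : 1 ≤ t) (x : ι → E) :
    IsTwoConcave 𝕜 t x (Fintype.card ι * ∑ j, ‖x j‖ ^ 2) := by
  classical
  intro N f c hf
  have h1 : ∀ j, ∑ i, ‖f i j‖ ^ 2 ≤ c := fun j => by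
    simpa [Pi.single_apply] using hf _ (single_mem_positiveUnitBall ht j)
  calc ∑ i, ‖∑ j, f i j • x j‖ ^ 2 ≤ ∑ i, Fintype.card ι * ∑ j, ‖f i j‖ ^ 2 * ‖x j‖ ^ 2 := by
        refine Finset.sum_le_sum fun i _ => ?_
        calc ‖∑ j, f i j • x j‖ ^ 2 ≤ (∑ j, ‖f i j • x j‖) ^ 2 := by
              gcongr; exact norm_sum_le _ _
          _ ≤ Fintype.card ι * ∑ j, ‖f i j • x j‖ ^ 2 := sq_sum_le_card_mul_sum_sq
          _ = _ := by simp only [norm_smul, mul_pow]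
    _ = Fintype.card ι * ∑ j, (∑ i, ‖f i j‖ ^ 2) * ‖x j‖ ^ 2 := by
        rw [← Finset.mul_sum, Finset.sum_comm]
        simp only [Finset.sum_mul]
    _ ≤ Fintype.card ι * ∑ j, c * ‖x j‖ ^ 2 := by gcongr with j; exact h1 j
    _ = _ := by rw [← Finset.mul_sum]; ring

theorem norm_sq_sum_smul_le_of_weak (hp : 1 ≤ p) (hp2 : p < 2)
    (hx : ∀ φ : StrongDual 𝕜 E, ‖φ‖ ≤ 1 → ∑ j, ‖φ (x j)‖ ^ p ≤ 1) (h : ι → 𝕜) (H : ι → ℝ)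
    (hH : ∀ j, ‖h j‖ ^ 2 ≤ H j) (c : ℝ)
    (hc : ∀ θ ∈ positiveUnitBall ι (p / (2 - p)), ∑ j, θ j * H j ≤ c) :
    ‖∑ j, h j • x j‖ ^ 2 ≤ c := by
  obtain ⟨φ, hφ, hφx⟩ := exists_dual_vector'' 𝕜 (∑ j, h j • x j)
  have ha : ∀ j, 0 ≤ ‖φ (x j)‖ := fun j => norm_nonneg _
  have h1 : ∑ j, ‖φ (x j)‖ ^ (2 - p) * H j ≤ c := by
    -- For a norming `φ`, this weight is admissible because its `p / (2 - p)`-th powers are `‖φ (x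
    -- j)‖ ^ p`. Cauchy–Schwarz with `‖φ‖² = ‖φ‖^(2-p) ‖φ‖^p` at each `x j` does the rest.
    refine hc (fun j => ‖φ (x j)‖ ^ (2 - p)) ⟨fun j => by positivity, ?_⟩
    refine (Finset.sum_congr rfl fun j _ => ?_).trans_le (hx φ hφ)
    rw [← Real.rpow_mul (ha j), mul_div_cancel₀ _ (by linarith)]
  have h2 : ‖∑ j, h j • x j‖ ≤ ∑ j, ‖h j‖ * ‖φ (x j)‖ := by
    have : ‖∑ j, h j • x j‖ = ‖φ (∑ j, h j • x j)‖ := by rw [hφx]; simp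
    rw [this, map_sum]
    refine (norm_sum_le _ _).trans_eq ?_
    simp
  have h3 := Finset.sum_sq_le_sum_mul_sum_of_sq_le_mul Finset.univ
    (r := fun j => ‖h j‖ * ‖φ (x j)‖) (f := fun j => ‖φ (x j)‖ ^ (2 - p) * ‖h j‖ ^ 2)
    (g := fun j => ‖φ (x j)‖ ^ p) (fun j _ => by positivity) (fun j _ => by positivity)
    fun j _ => by
      have : ‖φ (x j)‖ ^ (2 - p) * ‖φ (x j)‖ ^ p = ‖φ (x j)‖ ^ 2 := by
        rw [← Real.rpow_add_of_nonneg (ha j) (by linarith) (by linarith), ← Real.rpow_two]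
        congr 1; ring
      rw [mul_pow, ← this]
      exact le_of_eq (by ring)
  have h4 : ∑ j, ‖φ (x j)‖ ^ (2 - p) * ‖h j‖ ^ 2 ≤ c :=
    (Finset.sum_le_sum fun j _ => by gcongr; exact hH j).trans h1
  have h5 : 0 ≤ ∑ j, ‖φ (x j)‖ ^ (2 - p) * ‖h j‖ ^ 2 := by positivity
  calc ‖∑ j, h j • x j‖ ^ 2 ≤ (∑ j, ‖h j‖ * ‖φ (x j)‖) ^ 2 := by gcongr
    _ ≤ _ := h3
    _ ≤ (∑ j, ‖φ (x j)‖ ^ (2 - p) * ‖h j‖ ^ 2) * 1 := by gcongr; exact hx φ hφ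
    _ ≤ c := by linarith

/-- The tail of a Rademacher sum in mean square. -/
theorem expect_norm_sq_signedSum_tail_le {N : ℕ} (a : Fin N → 𝕜) {M : ℝ} (hM : 0 < M) :
    𝔼 ε, ‖if ‖signedSum a ε‖ ^ 2 ≤ M * ∑ i, ‖a i‖ ^ 2 then 0 else signedSum a ε‖ ^ 2
      ≤ 3 / M * ∑ i, ‖a i‖ ^ 2 := by
  set G := ∑ i, ‖a i‖ ^ 2 with hG
  have hG0 : 0 ≤ G := by positivity
  rcases hG0.eq_or_lt with h0 | h0
  -- The threshold is zero here and cannot be divided by, so the second moment, which vanishes, is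
  -- used instead.
  · have h1 := expect_norm_sq_signedSum a
    have h2 : ∀ ε, ‖if ‖signedSum a ε‖ ^ 2 ≤ M * G then 0 else signedSum a ε‖ ^ 2
        ≤ ‖signedSum a ε‖ ^ 2 := fun ε => by
      split_ifs
      · simp
      · exact le_rfl
    refine (Finset.expect_le_expect fun ε _ => h2 ε).trans ?_
    rw [h1, ← hG, ← h0, mul_zero]
  · have h1 : 𝔼 ε, ‖if ‖signedSum a ε‖ ^ 2 ≤ M * G then 0 else signedSum a ε‖ ^ 2 * (M * G)
        ≤ 3 * G ^ 2 := by
      have h2 : ∀ ε, ‖if ‖signedSum a ε‖ ^ 2 ≤ M * G then 0 else signedSum a ε‖ ^ 2 * (M * G)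
          ≤ ‖signedSum a ε‖ ^ 4 := fun ε => by
        split_ifs with h
        · simp
        · have := mul_le_mul_of_nonneg_left (not_le.1 h).le (sq_nonneg ‖signedSum a ε‖)
          linarith [show ‖signedSum a ε‖ ^ 4 = ‖signedSum a ε‖ ^ 2 * ‖signedSum a ε‖ ^ 2 by ring]
      exact (Finset.expect_le_expect fun ε _ => h2 ε).trans (expect_norm_pow_four_signedSum_le a)
    rw [← Finset.expect_mul, ← le_div_iff₀ (by positivity)] at h1
    refine h1.trans_eq ?_
    field_simp

/-- By cotype it suffices to bound the mean square of the image of a Rademacher sum. Truncate that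
sum in each coordinate: the bounded part is controlled by the weak `p`-bound alone, while the tail
is small by the fourth moment, so the old constant `L` returns with a small factor. -/
theorem IsTwoConcave.improve (hp : 1 ≤ p) (hp2 : p < 2)
    (hx : ∀ φ : StrongDual 𝕜 E, ‖φ‖ ≤ 1 → ∑ j, ‖φ (x j)‖ ^ p ≤ 1) {D : ℝ} (hD : 0 < D)
    (hE : ∀ (m : ℕ) (y : Fin m → E), ∑ j, ‖y j‖ ^ 2 ≤ D * 𝔼 ε, ‖signedSum y ε‖ ^ 2)
    (h : IsTwoConcave 𝕜 (p / (2 - p)) x L) :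
    IsTwoConcave 𝕜 (p / (2 - p)) x (24 * D ^ 2 + L / 2) := by
  intro N f c hc
  have hT : ∀ ε, signedSum (fun i => ∑ j, f i j • x j) ε
      = ∑ j, signedSum (fun i => f i j) ε • x j := fun ε => by
    simp only [signedSum, Finset.smul_sum, Finset.sum_smul, smul_assoc]
    exact Finset.sum_comm
  let G : ι → ℝ := fun j => ∑ i, ‖f i j‖ ^ 2
  -- The level `12 * D` makes the tail contribute `D * 2 * L * 3 / (12 * D) = L / 2`.
  let h₂ : (Fin N → ℤˣ) → ι → 𝕜 := fun ε j =>
    if ‖signedSum (fun i => f i j) ε‖ ^ 2 ≤ 12 * D * G j then 0 else signedSum (fun i => f i j) ε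
  let h₁ : (Fin N → ℤˣ) → ι → 𝕜 := fun ε j => signedSum (fun i => f i j) ε - h₂ ε j
  have hb₁ : ∀ ε, ‖∑ j, h₁ ε j • x j‖ ^ 2 ≤ 12 * D * c := fun ε => by
    refine norm_sq_sum_smul_le_of_weak hp hp2 hx _ (fun j => 12 * D * G j) (fun j => ?_) _
      fun θ hθ => ?_
    · have : 0 ≤ 12 * D * G j := by positivity
      simp only [h₁, h₂]
      split_ifs with hj
      · simpa using hj
      · simpa using this
    · have := mul_le_mul_of_nonneg_left (hc θ hθ) (by positivity : 0 ≤ 12 * D)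
      refine le_of_eq_of_le ?_ this
      rw [Finset.mul_sum]
      exact Finset.sum_congr rfl fun j _ => by ring
  have hb₂ : 𝔼 ε, ‖∑ j, h₂ ε j • x j‖ ^ 2 ≤ L * (3 / (12 * D) * c) := by
    refine h.expect_le h₂ _ fun θ hθ => ?_
    calc ∑ j, θ j * 𝔼 ε, ‖h₂ ε j‖ ^ 2 ≤ ∑ j, θ j * (3 / (12 * D) * G j) := by
          refine Finset.sum_le_sum fun j _ => mul_le_mul_of_nonneg_left ?_ (hθ.1 j)
          exact expect_norm_sq_signedSum_tail_le (fun i => f i j) (by positivity)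
      _ = 3 / (12 * D) * ∑ j, θ j * G j := by
          rw [Finset.mul_sum]
          exact Finset.sum_congr rfl fun j _ => by ring
      _ ≤ _ := mul_le_mul_of_nonneg_left (hc θ hθ) (by positivity)
  have hsplit : ∀ ε, ‖signedSum (fun i => ∑ j, f i j • x j) ε‖ ^ 2
      ≤ 2 * (12 * D * c) + 2 * ‖∑ j, h₂ ε j • x j‖ ^ 2 := fun ε => by
    have : signedSum (fun i => ∑ j, f i j • x j) ε
        = ∑ j, h₁ ε j • x j + ∑ j, h₂ ε j • x j := by
      rw [hT, ← Finset.sum_add_distrib]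
      exact Finset.sum_congr rfl fun j _ => by rw [← add_smul, sub_add_cancel]
    rw [this]
    have h3 := norm_add_le (∑ j, h₁ ε j • x j) (∑ j, h₂ ε j • x j)
    have h4 := pow_le_pow_left₀ (norm_nonneg _) h3 2
    nlinarith [hb₁ ε, sq_nonneg (‖∑ j, h₁ ε j • x j‖ - ‖∑ j, h₂ ε j • x j‖)]
  calc _ ≤ D * 𝔼 ε, ‖signedSum (fun i => ∑ j, f i j • x j) ε‖ ^ 2 := hE _ _
    _ ≤ D * 𝔼 ε, (2 * (12 * D * c) + 2 * ‖∑ j, h₂ ε j • x j‖ ^ 2) := by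
      gcongr with ε _
      exact hsplit ε
    _ = D * (2 * (12 * D * c) + 2 * 𝔼 ε, ‖∑ j, h₂ ε j • x j‖ ^ 2) := by
      rw [Finset.expect_add_distrib, Finset.mul_expect (M := ℝ) Finset.univ, Fintype.expect_const]
    _ ≤ D * (2 * (12 * D * c) + 2 * (L * (3 / (12 * D) * c))) := by gcongr
    _ = _ := by field_simp; ring

theorem isTwoConcave_of_cotype (hp : 1 ≤ p) (hp2 : p < 2)
    (hx : ∀ φ : StrongDual 𝕜 E, ‖φ‖ ≤ 1 → ∑ j, ‖φ (x j)‖ ^ p ≤ 1) {D : ℝ} (hD : 0 < D)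
    (hE : ∀ (m : ℕ) (y : Fin m → E), ∑ j, ‖y j‖ ^ 2 ≤ D * 𝔼 ε, ‖signedSum y ε‖ ^ 2) :
    IsTwoConcave 𝕜 (p / (2 - p)) x (48 * D ^ 2) := by
  have ht : 1 ≤ p / (2 - p) := by rw [le_div_iff₀ (by linarith)]; linarith
  set K : ℝ := Fintype.card ι * ∑ j, ‖x j‖ ^ 2
  -- `48 * D ^ 2` is the fixed point of `L ↦ 24 * D ^ 2 + L / 2`, and the excess halves at each
  -- step.
  have key : ∀ k : ℕ, IsTwoConcave 𝕜 (p / (2 - p)) x (48 * D ^ 2 + K * (1 / 2) ^ k) := fun k => by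
    induction k with
    | zero =>
      intro N f c hc
      have h1 := isTwoConcave_crude (𝕜 := 𝕜) ht x N f c hc
      have h2 : 0 ≤ c := by
        simpa [Real.zero_rpow (by linarith : p / (2 - p) ≠ 0)] using
          hc 0 ⟨fun _ => le_rfl, by simp [Real.zero_rpow (by linarith : p / (2 - p) ≠ 0)]⟩
      have : 0 ≤ 48 * D ^ 2 * c := by positivity
      rw [pow_zero, mul_one, add_mul]
      linarith
    | succ k ih =>
      have := ih.improve hp hp2 hx hD hE
      convert this using 1
      ring
  intro N f c hc
  have hlim : Filter.Tendsto (fun k : ℕ => (48 * D ^ 2 + K * (1 / 2) ^ k) * c) Filter.atTop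
      (nhds ((48 * D ^ 2 + K * 0) * c)) :=
    (((tendsto_pow_atTop_nhds_zero_of_lt_one (by norm_num) (by norm_num)).const_mul K).const_add
      _).mul_const c
  rw [mul_zero, add_zero] at hlim
  exact ge_of_tendsto' hlim fun k => key k N f c hc

/-- The desired inequalities are affine in `θ`. For a finite nonnegative combination, a maximizing
`θ` satisfies the combined inequality by `2`-concavity, and Ky Fan's lemma provides a common `θ`. -/
theorem exists_weight_of_isTwoConcave (ht : 1 ≤ t) (h : IsTwoConcave 𝕜 t x L) :
    ∃ θ ∈ positiveUnitBall ι t, ∀ f : ι → 𝕜,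
      ‖∑ j, f j • x j‖ ^ 2 ≤ L * ∑ j, θ j * ‖f j‖ ^ 2 := by
  obtain ⟨θ, hθ, hle⟩ := exists_forall_le_of_isCompact_convex (positiveUnitBall_nonempty ht)
    (convex_positiveUnitBall ht) (isCompact_positiveUnitBall ht)
    (fun (f : ι → 𝕜) j => L * ‖f j‖ ^ 2) (fun f => ‖∑ j, f j • x j‖ ^ 2) fun s w hw => by
      obtain ⟨θ, hθ, hmax⟩ := (isCompact_positiveUnitBall (ι := ι) ht).exists_isMaxOn
        (positiveUnitBall_nonempty ht)
        (f := fun θ => ∑ j, θ j * ∑ i : s, w i * ‖(i : ι → 𝕜) j‖ ^ 2)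
        (by fun_prop)
      refine ⟨θ, hθ, ?_⟩
      refine (h.sum_weight_mul_le w hw (fun i => (i : ι → 𝕜)) _ fun θ' hθ' => hmax hθ').trans_eq ?_
      simp only [Finset.mul_sum]
      rw [Finset.sum_comm]
      exact Finset.sum_congr rfl fun i _ => Finset.sum_congr rfl fun j _ => by ring
  refine ⟨θ, hθ, fun f => (hle f).trans_eq ?_⟩
  rw [Finset.mul_sum]
  exact Finset.sum_congr rfl fun j _ => by ring

/-- In a space of cotype `2`, a weakly `p`-summable family is the product of a scalar family and a
weakly `2`-summable family. -/
theorem exists_factorization (hp : 1 ≤ p) (hp2 : p < 2) {W : ℝ} (hW : 0 ≤ W)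
    (hx : ∀ φ : StrongDual 𝕜 E, ‖φ‖ ≤ 1 → ∑ j, ‖φ (x j)‖ ^ p ≤ W ^ p) {D : ℝ} (hD : 0 < D)
    (hE : ∀ (m : ℕ) (y : Fin m → E), ∑ j, ‖y j‖ ^ 2 ≤ D * 𝔼 ε, ‖signedSum y ε‖ ^ 2) :
    ∃ θ ∈ positiveUnitBall ι (p / (2 - p)), ∃ y : ι → E, (∀ j, x j = ((√(θ j) : ℝ) : 𝕜) • y j) ∧
      ∀ φ : StrongDual 𝕜 E, ‖φ‖ ≤ 1 → ∑ j, ‖φ (y j)‖ ^ 2 ≤ 48 * D ^ 2 * W ^ 2 := by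
  have ht : 1 ≤ p / (2 - p) := by rw [le_div_iff₀ (by linarith)]; linarith
  obtain ⟨θ, hθ, hle⟩ : ∃ θ ∈ positiveUnitBall ι (p / (2 - p)), ∀ f : ι → 𝕜,
      ‖∑ j, f j • x j‖ ^ 2 ≤ 48 * D ^ 2 * W ^ 2 * ∑ j, θ j * ‖f j‖ ^ 2 := by
    rcases hW.eq_or_lt with rfl | hW
    · obtain ⟨θ, hθ⟩ := positiveUnitBall_nonempty (ι := ι) ht
      refine ⟨θ, hθ, fun f => ?_⟩
      have : ∀ j, x j = 0 := fun j => by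
        obtain ⟨φ, hφ, hφx⟩ := exists_dual_vector'' 𝕜 (x j)
        have h1 := hx φ hφ
        rw [Real.zero_rpow (by linarith)] at h1
        have h2 := (Finset.sum_eq_zero_iff_of_nonneg fun j _ => by positivity).1
          (h1.antisymm (by positivity)) j (Finset.mem_univ j)
        rw [Real.rpow_eq_zero (norm_nonneg _) (by linarith), hφx] at h2
        simpa using h2
      simp [this]
    · have h1 := isTwoConcave_of_cotype (x := fun j => ((W⁻¹ : ℝ) : 𝕜) • x j) (ι := ι) hp hp2
        (fun φ hφ => by
          have := hx φ hφ
          simp only [map_smul, norm_smul, RCLike.norm_ofReal, abs_of_pos (inv_pos.2 hW)]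
          simp only [Real.mul_rpow (inv_pos.2 hW).le (norm_nonneg _), ← Finset.mul_sum]
          rw [Real.inv_rpow hW.le, inv_mul_le_iff₀ (by positivity), mul_one]
          exact this) hD hE
      obtain ⟨θ, hθ, hle⟩ := exists_weight_of_isTwoConcave ht h1
      refine ⟨θ, hθ, fun f => ?_⟩
      have h2 := hle f
      simp only [smul_comm _ ((W⁻¹ : ℝ) : 𝕜), ← Finset.smul_sum, norm_smul, RCLike.norm_ofReal,
        abs_of_pos (inv_pos.2 hW)] at h2
      rw [mul_pow, inv_pow, inv_mul_le_iff₀ (by positivity)] at h2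
      linarith
  refine ⟨θ, hθ, fun j => ((√(θ j) : ℝ) : 𝕜)⁻¹ • x j, fun j => ?_, fun φ hφ => ?_⟩
  -- Where the weight vanishes, testing with the `j`-th unit vector forces `x j = 0`, so nothing is
  -- lost.
  · by_cases h0 : θ j = 0
    · classical
      have h1 := hle (Pi.single j 1)
      have h2 : ∑ i, (Pi.single j 1 : ι → 𝕜) i • x i = x j := by
        simp [Pi.single_apply, ite_smul]
      have h3 : ∑ i, θ i * ‖(Pi.single j 1 : ι → 𝕜) i‖ ^ 2 = 0 := by
        refine Finset.sum_eq_zero fun i _ => ?_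
        by_cases hi : i = j
        · simp [hi, h0]
        · simp [hi]
      rw [h2, h3, mul_zero] at h1
      have : x j = 0 := by simpa using le_antisymm h1 (sq_nonneg _)
      simp [this]
    · have : ((√(θ j) : ℝ) : 𝕜) ≠ 0 := by
        simpa using (Real.sqrt_ne_zero (hθ.1 j)).2 h0
      rw [smul_inv_smul₀ this]
  · set y : ι → E := fun j => ((√(θ j) : ℝ) : 𝕜)⁻¹ • x j with hy
    set s := ∑ j, ‖φ (y j)‖ ^ 2 with hs
    have hs0 : 0 ≤ s := by positivity
    -- With this test vector `φ` takes the value `s` on the sum, so the bound becomes `s ^ 2 ≤ const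
    -- * s`.
    have h1 := hle fun j => (starRingEnd 𝕜) (φ (y j)) * ((√(θ j) : ℝ) : 𝕜)⁻¹
    have h2 : ∑ j, θ j * ‖(starRingEnd 𝕜) (φ (y j)) * ((√(θ j) : ℝ) : 𝕜)⁻¹‖ ^ 2 ≤ s := by
      refine Finset.sum_le_sum fun j _ => ?_
      rw [norm_mul, RCLike.norm_conj, norm_inv, RCLike.norm_ofReal, mul_pow, inv_pow, sq_abs,
        Real.sq_sqrt (hθ.1 j)]
      by_cases h0 : θ j = 0
      · simp [h0]
      · exact le_of_eq (by field_simp)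
    have h3 : s ≤ ‖∑ j, ((starRingEnd 𝕜) (φ (y j)) * ((√(θ j) : ℝ) : 𝕜)⁻¹) • x j‖ := by
      have h4 : φ (∑ j, ((starRingEnd 𝕜) (φ (y j)) * ((√(θ j) : ℝ) : 𝕜)⁻¹) • x j) = (s : 𝕜) := by
        rw [map_sum, hs, RCLike.ofReal_sum]
        refine Finset.sum_congr rfl fun j _ => ?_
        rw [mul_smul, map_smul, smul_eq_mul, RCLike.conj_mul, RCLike.ofReal_pow]
      have h5 := φ.le_of_opNorm_le hφ
        (∑ j, ((starRingEnd 𝕜) (φ (y j)) * ((√(θ j) : ℝ) : 𝕜)⁻¹) • x j)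
      rwa [h4, RCLike.norm_ofReal, abs_of_nonneg hs0, one_mul] at h5
    have h6 : s ^ 2 ≤ 48 * D ^ 2 * W ^ 2 * s :=
      (pow_le_pow_left₀ hs0 h3 2).trans (h1.trans (by gcongr))
    rcases hs0.eq_or_lt with h0 | h0
    · rw [← h0]; positivity
    · exact le_of_mul_le_mul_right (by linarith [sq s]) h0

end Concave

/-! ### Hölder's inequality and the conclusion -/

/-- If the domain spaces have cotype `2`, multiple `2`-summing mappings are multiple
`p`-summing for `1 ≤ p ≤ 2`. -/
theorem multipleSumming_two_subset {𝕜 : Type*} [RCLike 𝕜] {n : ℕ} {E : Fin n → Type*}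
    [∀ k, NormedAddCommGroup (E k)] [∀ k, NormedSpace 𝕜 (E k)] {F : Type*} [NormedAddCommGroup F]
    [NormedSpace 𝕜 F] (hE : ∀ k, HasCotype 2 (E k)) {p : ℝ} (hp : 1 ≤ p) (hp2 : p ≤ 2) :
    multipleSumming 𝕜 2 (fun _ => 2) E F ⊆ multipleSumming 𝕜 p (fun _ => p) E F := by
  rcases hp2.eq_or_lt with rfl | hp2
  · exact subset_rfl
  intro A hA
  obtain ⟨C, hC, h⟩ := exists_le_of_mem_multipleSumming one_le_two hA
  choose D hD hE using fun k => (hE k).exists_sum_sq_le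
  have hp0 : 0 < p := by linarith
  have h2p : 0 < 2 - p := by linarith
  have hB : 0 ≤ ∏ k, √(48 * D k ^ 2) := Finset.prod_nonneg fun _ _ => Real.sqrt_nonneg _
  refine mem_multipleSumming_of_le hp (C := C * ∏ k, √(48 * D k ^ 2)) (mul_nonneg hC hB)
    fun m x W hW hx => ?_
  choose θ hθ y hxy hy using fun k => exists_factorization hp hp2 (hW k) (hx k) (hD k) (hE k)
  have h1 := h (fun k => Fin (m k)) y (fun k => √(48 * D k ^ 2) * W k)
    (fun k => mul_nonneg (Real.sqrt_nonneg _) (hW k)) fun k φ hφ => by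
      simp only [Real.rpow_two]
      rw [mul_pow, Real.sq_sqrt (by positivity)]
      exact hy k φ hφ
  rw [Finset.prod_mul_distrib, ← mul_assoc] at h1
  have hR : 0 ≤ C * (∏ k, √(48 * D k ^ 2)) * ∏ k, W k :=
    mul_nonneg (mul_nonneg hC hB) (Finset.prod_nonneg fun k _ => hW k)
  have hA : ∀ j : ∀ k, Fin (m k), ‖A fun k => x k (j k)‖ ^ p
      = (∏ k, θ k (j k)) ^ (p / 2) * ‖A fun k => y k (j k)‖ ^ p := fun j => by
    have : (fun k => x k (j k)) = fun k => ((√(θ k (j k)) : ℝ) : 𝕜) • y k (j k) :=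
      funext fun k => hxy k (j k)
    have hprod : 0 ≤ ∏ k, θ k (j k) := Finset.prod_nonneg fun k _ => (hθ k).1 (j k)
    rw [this, A.map_smul_univ, norm_smul, norm_prod]
    simp only [RCLike.norm_ofReal, abs_of_nonneg (Real.sqrt_nonneg _)]
    rw [Real.mul_rpow (Finset.prod_nonneg fun _ _ => Real.sqrt_nonneg _) (norm_nonneg _)]
    congr 1
    simp only [Real.sqrt_eq_rpow]
    rw [Real.finsetProd_rpow _ _ fun k _ => (hθ k).1 (j k), ← Real.rpow_mul hprod]
    congr 1
    ring
  have hconj : (2 / (2 - p)).HolderConjugate (2 / p) := by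
    rw [Real.holderConjugate_iff]
    refine ⟨by rw [lt_div_iff₀ h2p]; linarith, ?_⟩
    field_simp
    ring
  -- The exponents combine to `p / (2 - p)`, and the sum over multi-indices splits into a product of
  -- sums, each at most `1`.
  have hweight : ∑ j : ∀ k, Fin (m k), ((∏ k, θ k (j k)) ^ (p / 2)) ^ (2 / (2 - p)) ≤ 1 := by
    have h2 : ∀ j : ∀ k, Fin (m k), ((∏ k, θ k (j k)) ^ (p / 2)) ^ (2 / (2 - p))
        = ∏ k, θ k (j k) ^ (p / (2 - p)) := fun j => by
      rw [← Real.rpow_mul (Finset.prod_nonneg fun k _ => (hθ k).1 (j k)),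
        Real.finsetProd_rpow _ _ fun k _ => (hθ k).1 (j k)]
      congr 1
      field_simp
    simp only [h2]
    rw [← Fintype.piFinset_univ, ← Finset.prod_univ_sum (fun _ => Finset.univ) fun k j => θ k j ^ (p / (2 - p))]
    exact Finset.prod_le_one
      (fun k _ => Finset.sum_nonneg fun j _ => Real.rpow_nonneg ((hθ k).1 j) _) fun k _ => (hθ k).2
  have hw0 : ∀ j : ∀ k, Fin (m k), 0 ≤ (∏ k, θ k (j k)) ^ (p / 2) := fun j =>
    Real.rpow_nonneg (Finset.prod_nonneg fun k _ => (hθ k).1 (j k)) _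
  simp only [hA]
  calc _ ≤ (∑ j : ∀ k, Fin (m k), ((∏ k, θ k (j k)) ^ (p / 2)) ^ (2 / (2 - p))) ^
          (1 / (2 / (2 - p))) *
        (∑ j : ∀ k, Fin (m k), (‖A fun k => y k (j k)‖ ^ p) ^ (2 / p)) ^ (1 / (2 / p)) :=
        Real.inner_le_Lp_mul_Lq_of_nonneg _ hconj (fun j _ => hw0 j) fun j _ => by positivity
    _ ≤ 1 * ((C * (∏ k, √(48 * D k ^ 2)) * ∏ k, W k) ^ (2 : ℝ)) ^ (1 / (2 / p)) := by
        gcongr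
        · exact Real.rpow_le_one (Finset.sum_nonneg fun j _ => Real.rpow_nonneg (hw0 j) _) hweight
            (by positivity)
        · refine le_of_eq_of_le (Finset.sum_congr rfl fun j _ => ?_) h1
          rw [← Real.rpow_mul (norm_nonneg _), mul_div_cancel₀ _ hp0.ne']
    _ = _ := by
        rw [one_mul, ← Real.rpow_mul hR]
        congr 1
        field_simp

theorem mainTheorem4 {𝕜 : Type*} [RCLike 𝕜] {n : ℕ} (hn : 1 ≤ n)
    (E : Fin n → Type*) [∀ k, NormedAddCommGroup (E k)] [∀ k, NormedSpace 𝕜 (E k)]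
    [∀ k, CompleteSpace (E k)]
    (F : Type*) [NormedAddCommGroup F] [NormedSpace 𝕜 F] [CompleteSpace F]
    (hE : ∀ k, HasCotype 2 (E k)) (hF : HasCotype 2 F)
    (p r : ℝ) (hp : 1 ≤ p) (hpr : p ≤ r) (hr : r ≤ 2) :
    multipleSumming 𝕜 p (fun _ => p) E F = multipleSumming 𝕜 r (fun _ => r) E F := by
  exact ((multipleSumming_subset_two hF hp (hpr.trans hr)).antisymm
    (multipleSumming_two_subset hE hp (hpr.trans hr))).trans
    ((multipleSumming_subset_two hF (hp.trans hpr) hr).antisymm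
      (multipleSumming_two_subset hE (hp.trans hpr) hr)).symm
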